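/- Let $w_0(x)=\log(e+|x|)$ for $x\in\mathbb R^2$. For $q\in[2,\infty)$ let $H^1L^q_{w_0}(\mathbb R^2)$ be the completion of the smooth compactly supported functions $u:\mathbb R^2\to\mathbb R$ with respect to the norm $$\|u\|_{w_0}^2=\int_{\mathbb R^2}|\nabla u|^2\,dx+\Big(\int_{\mathbb R^2}|u|^q\log(e+|x|)\,dx\Big)^{2/q},$$ and write $H^1_{w_0}(\mathbb R^2)=H^1L^2_{w_0}(\mathbb R^2)$. (i) For every $\alpha>0$ the functional $$H^1_{w_0}(\mathbb R^2)\to\mathbb R,\qquad u\mapsto\int_{\mathbb R^2}\big(e^{\alpha u^2}-1\big)\log(e+|x|)\,dx$$ is well defined (the integrand is integrable for every $u$) and continuous. (ii) Let $q\in[2,\infty)$. Let $c:\mathbb R^2\to\mathbb R$ be strictly positive, continuous and $1$-periodic in each variable, and let $f:[0,\infty)\to\mathbb R$ be differentiable with $f\ge 0$, $f(s)\le C s^{p}e^{4\pi s^2}$ for all large $s$, for some $p>0$ and some constant $C$, and $f(s)\asymp s^{q-1}$ as $s\to0^+$. Put $F(x,s)=c(x)\int_0^s f(t)\,dt$ for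 $s\ge 0$. Then for every $\alpha>0$ the functional $$H^1L^q_{w_0}(\mathbb R^2)\to\mathbb R,\qquad u\mapsto\int_{\mathbb R^2}F(x,\alpha|u|)\log(e+|x|)\,dx$$ is well defined (the integrand is integrable for every $u$) and continuous. -/

import Mathlib

open MeasureTheory Filter Topology
open scoped ENNReal ContDiff

noncomputable section

namespace LogWeighted

/-- The Euclidean plane. -/
abbrev Plane : Type := EuclideanSpace ℝ (Fin 2)

/-- The weight `w₀(x) = log (e + |x|)`. -/
def w₀ (x : Plane) : ℝ := Real.log (Real.exp 1 + ‖x‖)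

/-- The measure `w₀ dx` on the plane. -/
def weightedVolume : Measure Plane :=
  (volume : Measure Plane).withDensity fun x => ENNReal.ofReal (w₀ x)

/-- The Banach space `L^q(w₀ dx) × L²(dx; ℝ²)` with the norm
`‖(u, g)‖² = ‖u‖_{L^q(w₀ dx)}² + ‖g‖_{L²}²`. -/
abbrev Ambient (q : ℝ≥0∞) [Fact (1 ≤ q)] : Type :=
  WithLp 2 (Lp ℝ q weightedVolume × Lp Plane 2 (volume : Measure Plane))

/-- The smooth compactly supported functions `φ`, embedded as the pairs `(φ, ∇φ)`. The norm
inherited from the ambient space is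
`‖φ‖² = ‖∇φ‖_{L²}² + ‖φ‖_{L^q(w₀ dx)}²`. -/
def testPairs (q : ℝ≥0∞) [Fact (1 ≤ q)] : Submodule ℝ (Ambient q) where
  carrier := {p | ∃ φ : Plane → ℝ, ContDiff ℝ ∞ φ ∧ HasCompactSupport φ ∧
    p.fst =ᵐ[weightedVolume] φ ∧ p.snd =ᵐ[volume] gradient φ}
  zero_mem' := by
    refine ⟨0, contDiff_const, HasCompactSupport.zero, Lp.coeFn_zero _ _ _, ?_⟩
    refine (Lp.coeFn_zero _ _ _).trans (.of_forall fun x => ?_)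
    simp [gradient]
  add_mem' := by
    rintro p p' ⟨φ, hφ, hc, h1, h2⟩ ⟨ψ, hψ, hc', h1', h2'⟩
    refine ⟨φ + ψ, hφ.add hψ, hc.add hc', (Lp.coeFn_add _ _).trans (h1.add h1'),
      (Lp.coeFn_add _ _).trans ((h2.add h2').trans (.of_forall fun x => ?_))⟩
    have d1 : DifferentiableAt ℝ φ x := hφ.differentiable (by simp) x
    have d2 : DifferentiableAt ℝ ψ x := hψ.differentiable (by simp) x
    simp [gradient, fderiv_add d1 d2]
  smul_mem' := by
    rintro c p ⟨φ, hφ, hc, h1, h2⟩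
    refine ⟨c • φ, contDiff_const.smul hφ, hc.mono fun x hx => ?_,
      (Lp.coeFn_smul _ _).trans (h1.const_smul c),
      (Lp.coeFn_smul _ _).trans ((h2.const_smul c).trans (.of_forall fun x => ?_))⟩
    · intro h0
      exact hx (by simp [h0])
    · have d1 : DifferentiableAt ℝ φ x := hφ.differentiable (by simp) x
      simp [gradient, fderiv_const_smul d1 c]

/-- The space `H¹L^q_{w₀}(ℝ²)`: the completion of the smooth compactly supported functions with
respect to `‖φ‖² = ‖∇φ‖_{L²}² + ‖φ‖_{L^q(w₀ dx)}²`, realized as the closure of the isometric image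
`{(φ, ∇φ)}` in a complete space. Its elements are pairs `(u, g)` where `g` is the weak
gradient of `u`. -/
abbrev H1Lq (q : ℝ≥0∞) [Fact (1 ≤ q)] : Type := (testPairs q).topologicalClosure

/-- The space `H¹_{w₀}(ℝ²)`, with `‖u‖² = ∫ |∇u|² dx + ∫ u² log(e + |x|) dx`. -/
abbrev H1w₀ : Type := H1Lq 2

/-- The function (class) `u` underlying an element of `H¹L^q_{w₀}(ℝ²)`. -/
def H1Lq.toFun {q : ℝ≥0∞} [Fact (1 ≤ q)] (u : H1Lq q) : Plane → ℝ := (u : Ambient q).fst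

/-- Strictly positive, continuous coefficients that are `1`-periodic in each variable. -/
structure IsCoefficient (c : Plane → ℝ) : Prop where
  pos : ∀ x, 0 < c x
  continuous : Continuous c
  periodic : ∀ (i : Fin 2) (x : Plane), c (x + EuclideanSpace.single i 1) = c x

/-- The growth condition on the (differentiable) nonlinearity `f` on `[0, ∞)`: `f ≥ 0`,
`f(s) ≤ C s^p e^{4πs²}` as `s → +∞` for some `p > 0`, and `f(s) ≍ s^{q-1}` as `s → 0⁺`. -/
structure HasCriticalGrowth (q : ℝ) (f : ℝ → ℝ) : Prop where
  differentiableOn : DifferentiableOn ℝ f (Set.Ici 0)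
  nonneg : ∀ s, 0 ≤ s → 0 ≤ f s
  growth_infty : ∃ p : ℝ, 0 < p ∧ ∃ C : ℝ, ∀ᶠ s in atTop,
    f s ≤ C * s ^ p * Real.exp (4 * Real.pi * s ^ 2)
  growth_zero : f =Θ[𝓝[>] (0 : ℝ)] fun s => s ^ (q - 1)

/-- `F(x, s) = c(x) ∫₀ˢ f(t) dt`, the primitive in `s`, vanishing at `s = 0`,
of `f(x, s) = c(x) f(s)`. -/
def primitive (c : Plane → ℝ) (f : ℝ → ℝ) (x : Plane) (s : ℝ) : ℝ := c x * ∫ t in (0 : ℝ)..s, f t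

end LogWeighted

end

/-!
Both functionals are superposition functionals `u ↦ ∫ G (x, u) w₀ dx` in which `G (x, ·)` has local
Lipschitz constant at most `C |t| ^ (q - 1) exp (β t²)`. By Hölder's inequality they are finite and
locally Lipschitz as soon as all moments `∫ |u| ^ q exp (β u²) w₀ dx` are locally bounded on
`H¹L^q_{w₀}` (`integrable_and_continuous_integral`). Writing `u = φ + v` with a bounded test
function `φ` and a small `v`, and using Fatou's lemma, this reduces to a weighted Trudinger
inequality for test functions of small norm (`eventually_lintegral_expPow_le`,
`exists_lintegral_expPow_le_of_mem_closure`).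

The Trudinger inequality comes from the Sobolev inequality `‖ψ‖_{L²} ≤ C ‖∇ψ‖_{L¹}` of the plane,
applied to truncations of `φ` times `√W`, where `W` is a smooth weight comparable to `w₀`. With the
Cauchy-Schwarz inequality this gives
`W{φ ≥ s + h} ≤ C (h⁻² ∫_{s < φ < s + h} |∇φ|² + |{φ > s}|) W{φ > s}`
(`exists_smoothVolume_superlevel_le`); the weight does not enter the energy, because it is used up
by the measure of the superlevel set. Multiplying this inequality along `M j²` equal steps from
the level `j / 2` to the level `j`, and bounding the product of the ratios by the
arithmetic-geometric mean inequality, yields `W{φ > j} ≤ e^{-2 M j²} W{φ > 1 / 2}` when the energy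
is small in terms of `M` (`exists_superlevel_decay`). This decay beats any prescribed
`exp (β φ²)`.
-/

namespace LogWeighted

open Real

/-! ### A cut-off with bounded slope -/

theorem deriv_smoothTransition_eq_zero {t : ℝ} (ht : t ∉ Set.Ioo (0 : ℝ) 1) :
    deriv smoothTransition t = 0 := by
  rcases le_or_gt t 0 with h | h
  · refine IsLocalMin.deriv_eq_zero (.of_forall fun y => ?_)
    rw [smoothTransition.zero_of_nonpos h]
    exact smoothTransition.nonneg y
  · have h1 : 1 ≤ t := by
      by_contra h1
      exact ht ⟨h, not_le.1 h1⟩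
    refine IsLocalMax.deriv_eq_zero (.of_forall fun y => ?_)
    rw [smoothTransition.one_of_one_le h1]
    exact smoothTransition.le_one y

theorem norm_deriv_smoothTransition_le :
    ∃ K : ℝ, 0 < K ∧ ∀ t, ‖deriv smoothTransition t‖ ≤ K := by
  have hc : Continuous (deriv smoothTransition) :=
    (smoothTransition.contDiff (n := 1)).continuous_deriv le_rfl
  obtain ⟨K, hK⟩ := (isCompact_Icc (a := (0 : ℝ)) (b := 1)).exists_bound_of_continuousOn
    hc.continuousOn
  have hK0 : 0 ≤ K := (norm_nonneg _).trans (hK 0 (by simp))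
  refine ⟨K + 1, by linarith, fun t => ?_⟩
  by_cases ht : t ∈ Set.Ioo (0 : ℝ) 1
  · linarith [hK t (Set.Ioo_subset_Icc_self ht)]
  · rw [deriv_smoothTransition_eq_zero ht, norm_zero]
    linarith

/-! ### A smooth replacement for the weight -/

/-- The function `√(log (e² + |x|²))`. Its square lies between `w₀` and `2 * w₀`; unlike `√w₀`, it
is smooth at the origin. -/
noncomputable def sqrtWeight (x : Plane) : ℝ := √(log (exp 2 + ‖x‖ ^ 2))

theorem two_le_log_weight (x : Plane) : 2 ≤ log (exp 2 + ‖x‖ ^ 2) := by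
  rw [le_log_iff_exp_le (by positivity)]
  nlinarith [sq_nonneg ‖x‖]

theorem one_le_sqrtWeight (x : Plane) : 1 ≤ sqrtWeight x := by
  rw [sqrtWeight, one_le_sqrt]
  linarith [two_le_log_weight x]

theorem sqrtWeight_sq (x : Plane) : sqrtWeight x ^ 2 = log (exp 2 + ‖x‖ ^ 2) :=
  sq_sqrt (by linarith [two_le_log_weight x])

theorem exp_two_eq : exp 2 = exp 1 ^ 2 := by
  rw [← exp_nat_mul]; norm_num

theorem one_le_w₀ (x : Plane) : 1 ≤ w₀ x := by
  rw [w₀, le_log_iff_exp_le (by positivity)]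
  linarith [norm_nonneg x]

theorem w₀_le_sqrtWeight_sq (x : Plane) : w₀ x ≤ sqrtWeight x ^ 2 := by
  have h2 : (2 : ℝ) ≤ exp 2 + ‖x‖ ^ 2 := by
    nlinarith [add_one_le_exp (2 : ℝ), sq_nonneg ‖x‖]
  have : 2 * w₀ x ≤ 2 * log (exp 2 + ‖x‖ ^ 2) := by
    have e : ∀ y : ℝ, 2 * log y = log (y ^ 2) := fun y => by rw [log_pow]; norm_num
    rw [w₀, e, e]
    refine log_le_log (by positivity) ?_
    calc (exp 1 + ‖x‖) ^ 2 ≤ 2 * (exp 2 + ‖x‖ ^ 2) := by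
          rw [exp_two_eq]; nlinarith [sq_nonneg (exp 1 - ‖x‖)]
      _ ≤ (exp 2 + ‖x‖ ^ 2) ^ 2 := by nlinarith
  rw [sqrtWeight_sq]
  linarith

theorem sqrtWeight_sq_le (x : Plane) : sqrtWeight x ^ 2 ≤ 2 * w₀ x := by
  have e : 2 * log (exp 1 + ‖x‖) = log ((exp 1 + ‖x‖) ^ 2) := by rw [log_pow]; norm_num
  rw [sqrtWeight_sq, w₀, e]
  refine log_le_log (by positivity) ?_
  rw [exp_two_eq]
  nlinarith [norm_nonneg x, exp_pos 1, mul_nonneg (norm_nonneg x) (exp_pos 1).le]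

theorem contDiff_sqrtWeight : ContDiff ℝ 1 sqrtWeight := by
  refine ContDiff.sqrt (ContDiff.log (contDiff_const.add (contDiff_norm_sq ℝ)) fun x => ?_)
    fun x => ?_
  · positivity
  · linarith [two_le_log_weight x]

theorem norm_fderiv_sqrtWeight_le (x : Plane) : ‖fderiv ℝ sqrtWeight x‖ ≤ sqrtWeight x := by
  have h0 : HasFDerivAt (fun x : Plane => exp 2 + ‖x‖ ^ 2) (2 • innerSL ℝ x) x :=
    (hasStrictFDerivAt_norm_sq x).hasFDerivAt.const_add _
  have hpos : 0 < exp 2 + ‖x‖ ^ 2 := by positivity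
  have h1 := (h0.log hpos.ne').sqrt (by linarith [two_le_log_weight x])
  rw [show fderiv ℝ sqrtWeight x = _ from h1.fderiv, norm_smul, norm_smul]
  have hw := one_le_sqrtWeight x
  have a : ‖(2 • innerSL ℝ x : Plane →L[ℝ] ℝ)‖ ≤ 2 * ‖x‖ := by
    refine (norm_nsmul_le).trans ?_
    simp
  have b : ‖(exp 2 + ‖x‖ ^ 2)⁻¹‖ * ‖(2 • innerSL ℝ x : Plane →L[ℝ] ℝ)‖ ≤ 1 := by
    rw [norm_inv, norm_of_nonneg hpos.le, inv_mul_le_iff₀ hpos]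
    nlinarith [sq_nonneg (‖x‖ - 1), add_one_le_exp (2 : ℝ)]
  have c : ‖1 / (2 * √(log (exp 2 + ‖x‖ ^ 2)))‖ ≤ 1 := by
    change ‖1 / (2 * sqrtWeight x)‖ ≤ 1
    rw [norm_of_nonneg (by positivity), div_le_one (by positivity)]
    linarith
  exact (mul_le_one₀ c (by positivity) b).trans hw

/-- The measure with density `sqrtWeight ^ 2`, comparable to `w₀ dx`. -/
noncomputable def smoothVolume : Measure Plane :=
  (volume : Measure Plane).withDensity fun x => ENNReal.ofReal (sqrtWeight x) ^ 2

theorem weightedVolume_le_smoothVolume : weightedVolume ≤ smoothVolume := by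
  refine withDensity_mono (.of_forall fun x => ?_)
  beta_reduce
  rw [← ENNReal.ofReal_pow (by linarith [one_le_sqrtWeight x])]
  exact ENNReal.ofReal_le_ofReal (w₀_le_sqrtWeight_sq x)

theorem continuous_w₀ : Continuous w₀ :=
  (continuous_const.add continuous_norm).log fun x =>
    (by positivity : 0 < exp 1 + ‖x‖).ne'

theorem smoothVolume_le (s : Set Plane) : smoothVolume s ≤ 2 * weightedVolume s := by
  have : smoothVolume ≤ (2 : ℝ≥0∞) • weightedVolume := by
    rw [weightedVolume, ← withDensity_smul _ continuous_w₀.measurable.ennreal_ofReal]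
    refine withDensity_mono (.of_forall fun x => ?_)
    simp only [Pi.smul_apply, smul_eq_mul]
    rw [← ENNReal.ofReal_pow (by linarith [one_le_sqrtWeight x])]
    rw [← ENNReal.ofReal_ofNat, ← ENNReal.ofReal_mul (by norm_num)]
    exact ENNReal.ofReal_le_ofReal (sqrtWeight_sq_le x)
  exact this s

theorem volume_le_weightedVolume : (volume : Measure Plane) ≤ weightedVolume := by
  nth_rewrite 1 [← withDensity_one (μ := (volume : Measure Plane))]
  refine withDensity_mono (.of_forall fun x => ?_)
  simpa using one_le_w₀ x

/-! ### Passing from one level to the next -/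

/-- The Cauchy-Schwarz inequality without roots. -/
theorem sq_lintegral_mul_le {α : Type*} [MeasurableSpace α] (μ : Measure α) {f g : α → ℝ≥0∞}
    (hf : AEMeasurable f μ) (hg : AEMeasurable g μ) :
    (∫⁻ x, f x * g x ∂μ) ^ 2 ≤ (∫⁻ x, f x ^ 2 ∂μ) * ∫⁻ x, g x ^ 2 ∂μ := by
  have h := ENNReal.lintegral_mul_le_Lp_mul_Lq μ (p := 2) (q := 2)
    (by rw [Real.holderConjugate_iff]; norm_num) hf hg
  simp only [ENNReal.rpow_two, Pi.mul_apply] at h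
  calc (∫⁻ x, f x * g x ∂μ) ^ 2
      ≤ ((∫⁻ x, f x ^ 2 ∂μ) ^ (1 / 2 : ℝ) * (∫⁻ x, g x ^ 2 ∂μ) ^ (1 / 2 : ℝ)) ^ 2 := by gcongr
    _ = _ := by
      rw [mul_pow, ← ENNReal.rpow_mul_natCast, ← ENNReal.rpow_mul_natCast]
      norm_num

/-- One step between the levels `s` and `s + h`: the Gagliardo-Nirenberg-Sobolev inequality
`‖ψ‖_{L²} ≤ C ‖∇ψ‖_{L¹}`, applied to `ψ = T ((φ - s) / h) * sqrtWeight` with a smooth step `T`. The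
weight goes with the Cauchy-Schwarz inequality to the measure of the superlevel set, so that the
energy on the right-hand side is unweighted. -/
theorem exists_smoothVolume_superlevel_le : ∃ C : ℝ, 1 ≤ C ∧ ∀ φ : Plane → ℝ, ContDiff ℝ 1 φ →
    HasCompactSupport φ → ∀ s h : ℝ, 0 < s → 0 < h →
      smoothVolume {x | s + h ≤ φ x} ≤ ENNReal.ofReal C *
        (ENNReal.ofReal (1 / h ^ 2) *
            (∫⁻ x in {x | φ x ∈ Set.Ioo s (s + h)}, ‖fderiv ℝ φ x‖ₑ ^ 2)
          + volume {x | s < φ x}) * smoothVolume {x | s < φ x} := by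
  obtain ⟨K, hK0, hK⟩ := norm_deriv_smoothTransition_le
  set C₁ := (lintegralPowLePowLIntegralFDerivConst (volume : Measure Plane) 2 : NNReal)
  refine ⟨2 * C₁ * (K ^ 2 + 1) + 1, by
    have : 0 ≤ 2 * (C₁ : ℝ) * (K ^ 2 + 1) := by positivity
    linarith, ?_⟩
  intro φ hφ hc s h hs hh
  set ψ : Plane → ℝ := fun x => smoothTransition ((φ x - s) / h) * sqrtWeight x with hψ
  set A : Set Plane := {x | φ x ∈ Set.Ioo s (s + h)} with hA
  set B : Set Plane := {x | s < φ x} with hB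
  set w : Plane → ℝ≥0∞ := fun x => ENNReal.ofReal (sqrtWeight x) with hw
  have hwm : Measurable w := contDiff_sqrtWeight.continuous.measurable.ennreal_ofReal
  have hAm : MeasurableSet A := hφ.continuous.measurable measurableSet_Ioo
  have hBm : MeasurableSet B := measurableSet_lt measurable_const hφ.continuous.measurable
  have hAB : A ⊆ B := fun x hx => hx.1
  have hdm : Measurable fun x => ‖fderiv ℝ φ x‖ₑ :=
    (hφ.continuous_fderiv (by simp)).measurable.enorm
  have hT : ContDiff ℝ 1 fun x => smoothTransition ((φ x - s) / h) :=
    smoothTransition.contDiff.comp ((hφ.sub contDiff_const).div_const h)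
  have hψC : ContDiff ℝ 1 ψ := hT.mul contDiff_sqrtWeight
  have hψc : HasCompactSupport ψ := by
    refine hc.mono fun x hx => ?_
    contrapose! hx
    have hx : φ x = 0 := by simpa using hx
    have : smoothTransition ((φ x - s) / h) = 0 :=
      smoothTransition.zero_of_nonpos (div_nonpos_of_nonpos_of_nonneg (by linarith) hh.le)
    simp [ψ, this]
  have hsv : ∀ S, MeasurableSet S → smoothVolume S = ∫⁻ x in S, w x ^ 2 := fun S hS =>
    withDensity_apply _ hS
  -- The slope of the step lives on `A`; the gradient of the weight function is seen on all of `B`.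
  have hD : ∀ x, ‖fderiv ℝ ψ x‖ₑ ≤
      A.indicator (fun x => ENNReal.ofReal (K / h) * ‖fderiv ℝ φ x‖ₑ * w x) x
        + B.indicator (fun x => 1 * w x) x := by
    intro x
    have d1 : HasFDerivAt (fun x => (φ x - s) / h) (h⁻¹ • fderiv ℝ φ x) x := by
      simpa [div_eq_inv_mul] using
        (((hφ.differentiable (by simp) x).hasFDerivAt.sub_const s).const_mul h⁻¹)
    have d2 : HasDerivAt smoothTransition (deriv smoothTransition ((φ x - s) / h))
        ((φ x - s) / h) :=
      ((smoothTransition.contDiff (n := 1)).differentiable (by simp) _).hasDerivAt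
    have d3 := (d2.comp_hasFDerivAt x d1).mul
      (contDiff_sqrtWeight.differentiable (by simp) x).hasFDerivAt
    have d4 : fderiv ℝ ψ x = smoothTransition ((φ x - s) / h) • fderiv ℝ sqrtWeight x
        + sqrtWeight x • deriv smoothTransition ((φ x - s) / h) • h⁻¹ • fderiv ℝ φ x := d3.fderiv
    rw [d4, add_comm]
    refine (enorm_add_le (E := Plane →L[ℝ] ℝ) _ _).trans (add_le_add ?_ ?_)
    · by_cases hx : x ∈ A
      · rw [Set.indicator_of_mem hx, enorm_smul, enorm_smul, enorm_smul]
        have e1 : ‖sqrtWeight x‖ₑ = w x := by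
          rw [Real.enorm_eq_ofReal (by linarith [one_le_sqrtWeight x])]
        have e2 : ‖deriv smoothTransition ((φ x - s) / h)‖ₑ ≤ ENNReal.ofReal K := by
          rw [← ofReal_norm]
          exact ENNReal.ofReal_le_ofReal (hK _)
        have e3 : ENNReal.ofReal (K / h) = ENNReal.ofReal K * ENNReal.ofReal h⁻¹ := by
          rw [div_eq_mul_inv, ENNReal.ofReal_mul hK0.le]
        rw [e1, Real.enorm_eq_ofReal (by positivity : 0 ≤ h⁻¹), e3, mul_comm (w x), ← mul_assoc]
        gcongr
      · have : deriv smoothTransition ((φ x - s) / h) = 0 := by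
          refine deriv_smoothTransition_eq_zero fun ht => hx ?_
          have h1 := (div_pos_iff_of_pos_right hh).1 ht.1
          have h2 := (div_lt_one hh).1 ht.2
          exact ⟨by linarith, by linarith⟩
        rw [this, zero_smul, smul_zero]
        rw [← ofReal_norm, norm_zero, ENNReal.ofReal_zero]
        exact zero_le
    · by_cases hx : x ∈ B
      · rw [Set.indicator_of_mem hx, enorm_smul]
        gcongr
        · rw [Real.enorm_eq_ofReal (smoothTransition.nonneg _)]
          exact ENNReal.ofReal_le_one.2 (smoothTransition.le_one _)
        · rw [← ofReal_norm]
          exact ENNReal.ofReal_le_ofReal (norm_fderiv_sqrtWeight_le x)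
      · have : smoothTransition ((φ x - s) / h) = 0 :=
          smoothTransition.zero_of_nonpos
            (div_nonpos_of_nonpos_of_nonneg (by linarith [not_lt.1 (show ¬ s < φ x from hx)]) hh.le)
        rw [this, zero_smul]
        rw [← ofReal_norm, norm_zero, ENNReal.ofReal_zero]
        exact zero_le
  have hS := lintegral_pow_le_pow_lintegral_fderiv (volume : Measure Plane) hψC hψc (p := 2)
    (by rw [Real.holderConjugate_iff]; norm_num)
  simp only [ENNReal.rpow_two] at hS
  have h1 : smoothVolume {x | s + h ≤ φ x} ≤ ∫⁻ x, ‖ψ x‖ₑ ^ 2 := by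
    have hm : MeasurableSet {x | s + h ≤ φ x} :=
      measurableSet_le measurable_const hφ.continuous.measurable
    rw [hsv _ hm, ← lintegral_indicator hm]
    refine lintegral_mono fun x => ?_
    by_cases hx : s + h ≤ φ x
    · rw [Set.indicator_of_mem (by exact hx)]
      have : smoothTransition ((φ x - s) / h) = 1 :=
        smoothTransition.one_of_one_le ((one_le_div hh).2 (by linarith))
      simp only [ψ, this, one_mul]
      rw [Real.enorm_eq_ofReal (by linarith [one_le_sqrtWeight x])]
    · rw [Set.indicator_of_notMem (by exact hx)]
      exact zero_le
  have h2 : (∫⁻ x, ‖fderiv ℝ ψ x‖ₑ) ^ 2 ≤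
      2 * ((ENNReal.ofReal (K / h) ^ 2 * ∫⁻ x in A, ‖fderiv ℝ φ x‖ₑ ^ 2) * smoothVolume B
        + volume B * smoothVolume B) := by
    have i1 : ∫⁻ x, ‖fderiv ℝ ψ x‖ₑ ≤
        (∫⁻ x in A, ENNReal.ofReal (K / h) * ‖fderiv ℝ φ x‖ₑ * w x) + ∫⁻ x in B, 1 * w x := by
      rw [← lintegral_indicator hAm, ← lintegral_indicator hBm, ← lintegral_add_left]
      · exact lintegral_mono hD
      · exact ((measurable_const.mul hdm).mul hwm).indicator hAm
    have i2 := sq_lintegral_mul_le (volume.restrict A)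
      (f := fun x => ENNReal.ofReal (K / h) * ‖fderiv ℝ φ x‖ₑ) (g := w)
      (measurable_const.mul hdm).aemeasurable hwm.aemeasurable
    have i3 := sq_lintegral_mul_le (volume.restrict B) (f := fun _ => 1) (g := w)
      aemeasurable_const hwm.aemeasurable
    simp only [mul_pow] at i2
    rw [lintegral_const_mul _ (hdm.pow_const 2), ← hsv A hAm] at i2
    rw [← hsv B hBm] at i3
    simp only [one_pow, lintegral_const, Measure.restrict_apply MeasurableSet.univ,
      Set.univ_inter, one_mul] at i3
    have i4 := ENNReal.rpow_add_le_mul_rpow_add_rpow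
      (∫⁻ x in A, ENNReal.ofReal (K / h) * ‖fderiv ℝ φ x‖ₑ * w x) (∫⁻ x in B, 1 * w x)
      (p := 2) (by norm_num)
    simp only [ENNReal.rpow_two] at i4
    norm_num at i4
    calc (∫⁻ x, ‖fderiv ℝ ψ x‖ₑ) ^ 2 ≤ _ := pow_le_pow_left' i1 2
      _ ≤ _ := by simpa using i4
      _ ≤ _ := by
        gcongr 2 * (?_ + ?_)
        exact i2.trans (by gcongr)
  calc smoothVolume {x | s + h ≤ φ x} ≤ _ := h1.trans hS
    _ ≤ C₁ * (2 * ((ENNReal.ofReal (K / h) ^ 2 * ∫⁻ x in A, ‖fderiv ℝ φ x‖ₑ ^ 2)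
        * smoothVolume B + volume B * smoothVolume B)) := by gcongr
    _ = (2 * C₁ * (ENNReal.ofReal (K ^ 2) * (ENNReal.ofReal (1 / h ^ 2) *
          (∫⁻ x in A, ‖fderiv ℝ φ x‖ₑ ^ 2)) + 1 * volume B)) * smoothVolume B := by
        rw [← ENNReal.ofReal_pow (by positivity), div_pow, div_eq_mul_one_div,
          ENNReal.ofReal_mul (by positivity)]
        ring
    _ ≤ (2 * C₁ * (ENNReal.ofReal (K ^ 2 + 1) * (ENNReal.ofReal (1 / h ^ 2) *
          (∫⁻ x in A, ‖fderiv ℝ φ x‖ₑ ^ 2)) + ENNReal.ofReal (K ^ 2 + 1) * volume B))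
          * smoothVolume B := by
        gcongr
        · linarith
        · rw [ENNReal.one_le_ofReal]; nlinarith
    _ = ENNReal.ofReal (2 * C₁ * (K ^ 2 + 1)) * (ENNReal.ofReal (1 / h ^ 2) *
          (∫⁻ x in A, ‖fderiv ℝ φ x‖ₑ ^ 2) + volume B) * smoothVolume B := by
        rw [ENNReal.ofReal_mul (by positivity), ENNReal.ofReal_mul (by positivity),
          ENNReal.ofReal_ofNat, ENNReal.ofReal_coe_nnreal]
        ring
    _ ≤ _ := by
        gcongr
        linarith

/-! ### Gaussian decay of the superlevel sets -/

/-- If the average of the ratios `a k` over `k < N` is at most `e⁻²`, then `m` decays by `e⁻²` per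
step on average: the arithmetic-geometric mean inequality for the product of the `a k`. -/
theorem le_exp_neg_mul_of_step {m a : ℕ → ℝ≥0∞} (N : ℕ) (hm : ∀ k, m (k + 1) ≤ a k * m k)
    (ha : ∑ k ∈ Finset.range N, a k ≤ ENNReal.ofReal (N * exp (-2))) :
    m N ≤ ENNReal.ofReal (exp (-2 * N)) * m 0 := by
  have hfin : ∀ k ∈ Finset.range N, a k ≠ ⊤ := fun k hk =>
    ne_top_of_le_ne_top ENNReal.ofReal_ne_top
      ((Finset.single_le_sum (fun _ _ => zero_le) hk).trans ha)
  have key : ∀ n ≤ N, m n ≤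
      ENNReal.ofReal (exp (∑ k ∈ Finset.range n, (exp 2 * (a k).toReal - 3))) * m 0 := by
    intro n
    induction n with
    | zero => simp
    | succ n ih =>
      intro hn
      -- This is `t ≤ exp (t - 1)` at `t = exp 2 * a n`.
      have h1 : a n ≤ ENNReal.ofReal (exp (exp 2 * (a n).toReal - 3)) := by
        rw [← ENNReal.ofReal_toReal (hfin n (Finset.mem_range.2 hn))]
        refine ENNReal.ofReal_le_ofReal ?_
        rw [ENNReal.toReal_ofReal ENNReal.toReal_nonneg]
        have h2 := add_one_le_exp (exp 2 * (a n).toReal - 1)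
        have h3 : exp (exp 2 * (a n).toReal - 1) =
            exp 2 * exp (exp 2 * (a n).toReal - 3) := by
          rw [← exp_add]; ring_nf
        rw [h3] at h2
        exact le_of_mul_le_mul_left (by linarith) (exp_pos 2)
      calc m (n + 1) ≤ a n * m n := hm n
        _ ≤ ENNReal.ofReal (exp (exp 2 * (a n).toReal - 3)) *
            (ENNReal.ofReal (exp (∑ k ∈ Finset.range n, (exp 2 * (a k).toReal - 3))) * m 0) := by
          gcongr
          exact ih (by omega)
        _ = _ := by
          rw [← mul_assoc, ← ENNReal.ofReal_mul (exp_pos _).le, ← exp_add,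
            Finset.sum_range_succ, add_comm]
  refine (key N le_rfl).trans ?_
  gcongr
  have h1 : ∑ k ∈ Finset.range N, (a k).toReal ≤ N * exp (-2) := by
    rw [← ENNReal.toReal_sum hfin]
    exact ENNReal.toReal_le_of_le_ofReal (by positivity) ha
  have h2 : exp 2 * (N * exp (-2)) = N := by
    rw [mul_left_comm, ← exp_add]; simp
  rw [Finset.sum_sub_distrib, ← Finset.mul_sum]
  have h3 := mul_le_mul_of_nonneg_left h1 (exp_pos 2).le
  rw [h2] at h3
  simp
  linarith

/-- Gaussian decay of the superlevel sets, at any prescribed rate `M`, for functions with small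
energy and a small superlevel set `{φ > 1 / 2}`: the range from `j / 2` to `j` is divided into
`M * j ^ 2` equal steps. The energies between consecutive levels add up to at most the total
energy `η`, whereas the factor `1 / h²` is `4 * M` times the number of steps, so the average ratio
in `exists_smoothVolume_superlevel_le` is at most `C * (4 * M + 1) * η`, uniformly in `j`. -/
theorem exists_superlevel_decay (M : ℕ) (hM : 1 ≤ M) : ∃ η : ℝ, 0 < η ∧ ∀ φ : Plane → ℝ,
    ContDiff ℝ 1 φ → HasCompactSupport φ →
    ∫⁻ x, ‖fderiv ℝ φ x‖ₑ ^ 2 ≤ ENNReal.ofReal η →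
    volume {x | 1 / 2 < φ x} ≤ ENNReal.ofReal η → ∀ j : ℕ, 1 ≤ j →
      smoothVolume {x | (j : ℝ) < φ x} ≤
        ENNReal.ofReal (exp (-2 * (M * j ^ 2 : ℕ))) * smoothVolume {x | 1 / 2 < φ x} := by
  obtain ⟨C, hC1, hC⟩ := exists_smoothVolume_superlevel_le
  have hC0 : 0 < C := by linarith
  refine ⟨exp (-2) / (C * (4 * M + 1)), by positivity, fun φ hφ hc hE hV j hj => ?_⟩
  set η := exp (-2) / (C * (4 * M + 1)) with hη
  have hη0 : 0 < η := by positivity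
  have hM0 : (0 : ℝ) < M := by exact_mod_cast hM
  have hj1 : (1 : ℝ) ≤ j := by exact_mod_cast hj
  have hj0 : (0 : ℝ) < j := by linarith
  set h : ℝ := 1 / (2 * M * j) with hh
  have hh0 : 0 < h := by positivity
  set s : ℕ → ℝ := fun k => j / 2 + k * h with hs
  have hs2 : ∀ k, 1 / 2 ≤ s k := fun k => by
    have : 0 ≤ k * h := by positivity
    simp only [s]; linarith
  have hss : ∀ k, s (k + 1) = s k + h := fun k => by simp only [s]; push_cast; ring
  set N := M * j ^ 2 with hN
  have hsN : s N = j := by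
    simp only [s, hN, hh]; push_cast; field_simp; ring
  set A : ℕ → Set Plane := fun k => {x | φ x ∈ Set.Ioo (s k) (s k + h)} with hA
  have hAm : ∀ k, MeasurableSet (A k) := fun k =>
    hφ.continuous.measurable measurableSet_Ioo
  set V := volume {x | 1 / 2 < φ x} with hVdef
  set a : ℕ → ℝ≥0∞ := fun k => ENNReal.ofReal C *
    (ENNReal.ofReal (1 / h ^ 2) * (∫⁻ x in A k, ‖fderiv ℝ φ x‖ₑ ^ 2) + V) with ha
  have hmono : Monotone s := monotone_nat_of_le_succ fun k => by rw [hss]; linarith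
  have hdisj : Set.PairwiseDisjoint (Finset.range N : Set ℕ) A := by
    intro k _ l _ hkl
    rw [Function.onFun, Set.disjoint_left]
    rintro x ⟨h1, h2⟩ ⟨h3, h4⟩
    rw [← hss] at h2 h4
    rcases lt_or_gt_of_ne hkl with hlt | hlt
    · linarith [hmono (Nat.succ_le_of_lt hlt)]
    · linarith [hmono (Nat.succ_le_of_lt hlt)]
  have hsum : ∑ k ∈ Finset.range N, a k ≤ ENNReal.ofReal (N * exp (-2)) := by
    have e1 : ∑ k ∈ Finset.range N, ∫⁻ x in A k, ‖fderiv ℝ φ x‖ₑ ^ 2 ≤ ENNReal.ofReal η := by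
      rw [← lintegral_biUnion_finset hdisj fun k _ => hAm k]
      exact (setLIntegral_le_lintegral _ _).trans hE
    calc ∑ k ∈ Finset.range N, a k
        = ENNReal.ofReal C * (ENNReal.ofReal (1 / h ^ 2) *
            (∑ k ∈ Finset.range N, ∫⁻ x in A k, ‖fderiv ℝ φ x‖ₑ ^ 2) + N * V) := by
          simp only [a, ← Finset.mul_sum, Finset.sum_add_distrib, Finset.sum_const,
            Finset.card_range, nsmul_eq_mul]
      _ ≤ ENNReal.ofReal C * (ENNReal.ofReal (1 / h ^ 2) * ENNReal.ofReal η
            + N * ENNReal.ofReal η) := by gcongr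
      _ = ENNReal.ofReal (C * (1 / h ^ 2 * η + N * η)) := by
          rw [ENNReal.ofReal_mul hC0.le, ENNReal.ofReal_add (by positivity) (by positivity),
            ENNReal.ofReal_mul (by positivity), ENNReal.ofReal_mul (by positivity),
            ENNReal.ofReal_natCast]
      _ = ENNReal.ofReal (N * exp (-2)) := by
          congr 1
          have : 1 / h ^ 2 = 4 * M * N := by
            simp only [hh, hN]; push_cast; field_simp; ring
          rw [this, hη]
          field_simp
  have hstep : ∀ k, smoothVolume {x | s (k + 1) < φ x} ≤ a k * smoothVolume {x | s k < φ x} := by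
    intro k
    refine (measure_mono fun x hx => ?_).trans
      ((hC φ hφ hc (s k) h (by linarith [hs2 k]) hh0).trans ?_)
    · rw [hss] at hx
      exact le_of_lt (show s k + h < φ x from hx)
    · simp only [a]
      gcongr
      exact measure_mono fun x hx => lt_of_le_of_lt (hs2 k) hx
  have hfin := le_exp_neg_mul_of_step (m := fun k => smoothVolume {x | s k < φ x}) N hstep hsum
  beta_reduce at hfin
  rw [hsN] at hfin
  refine hfin.trans ?_
  gcongr
  exact hs2 0

/-! ### Exponential integrability of test functions -/

theorem ofReal_exp_le_tsum {β t : ℝ} (hβ : 0 ≤ β) (ht : 1 < |t|) :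
    ENNReal.ofReal (exp (β * t ^ 2)) ≤ ∑' j : ℕ, {y : ℝ | ((j + 1 : ℕ) : ℝ) < |y|}.indicator
      (fun _ => ENNReal.ofReal (exp (4 * β * ((j + 1 : ℕ) : ℝ) ^ 2))) t := by
  have h0 : 2 ≤ ⌈|t|⌉₊ := by
    have : 1 < ⌈|t|⌉₊ := Nat.lt_ceil.2 (by simpa using ht)
    omega
  obtain ⟨j, hj⟩ := Nat.exists_eq_add_of_le h0
  have h1 : ((j + 1 : ℕ) : ℝ) < |t| := Nat.lt_ceil.1 (by omega)
  have h2 : |t| ≤ (2 + j : ℕ) := by rw [← hj]; exact Nat.le_ceil _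
  refine le_trans ?_ (ENNReal.le_tsum j)
  rw [Set.indicator_of_mem (by exact h1)]
  refine ENNReal.ofReal_le_ofReal (exp_le_exp.2 ?_)
  rw [← sq_abs, mul_comm 4 β, mul_assoc]
  gcongr
  have h3 : |t| ≤ 2 * (j + 1 : ℕ) := h2.trans (by push_cast; linarith)
  calc |t| ^ 2 ≤ (2 * (j + 1 : ℕ)) ^ 2 := by gcongr
    _ = _ := by ring

/-- A weighted Trudinger inequality on `{|φ| > 1}`, by summing the Gaussian decay of the
superlevel sets of `φ` and `-φ` over the integer levels. -/
theorem exists_lintegral_exp_le {β : ℝ} (hβ : 0 ≤ β) : ∃ η : ℝ, 0 < η ∧ ∃ K : ℝ≥0∞, K ≠ ⊤ ∧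
    ∀ φ : Plane → ℝ, ContDiff ℝ 1 φ → HasCompactSupport φ →
    ∫⁻ x, ‖fderiv ℝ φ x‖ₑ ^ 2 ≤ ENNReal.ofReal η →
    weightedVolume {x | 1 / 2 < |φ x|} ≤ ENNReal.ofReal η →
      ∫⁻ x in {x | 1 < |φ x|}, ENNReal.ofReal (exp (β * φ x ^ 2)) ∂weightedVolume ≤ K := by
  -- With this rate, `4 * β * j ^ 2 - 2 * M * j ^ 2 ≤ -2 * j ^ 2`.
  obtain ⟨M, hM⟩ := exists_nat_ge (2 * β + 1)
  have hM1 : 1 ≤ M := by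
    have : (1 : ℝ) ≤ M := by linarith
    exact_mod_cast this
  obtain ⟨η, hη, H⟩ := exists_superlevel_decay M hM1
  have hs : Summable fun j : ℕ => 4 * η * exp (-((j + 1 : ℕ) : ℝ)) :=
    ((summable_nat_add_iff 1).2 summable_exp_neg_nat).mul_left _
  refine ⟨η, hη, _, hs.tsum_ofReal_ne_top, fun φ hφ hc hE hV => ?_⟩
  have hm : ∀ t : ℝ, MeasurableSet {x | t < |φ x|} := fun t =>
    measurableSet_lt measurable_const hφ.continuous.abs.measurable
  have hle : ∀ j : ℕ, 1 ≤ j → weightedVolume {x | (j : ℝ) < |φ x|} ≤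
      ENNReal.ofReal (4 * η * exp (-2 * (M * j ^ 2 : ℕ))) := by
    have hone : ∀ ψ : Plane → ℝ, ContDiff ℝ 1 ψ → HasCompactSupport ψ →
        ∫⁻ x, ‖fderiv ℝ ψ x‖ₑ ^ 2 ≤ ENNReal.ofReal η →
        weightedVolume {x | 1 / 2 < ψ x} ≤ ENNReal.ofReal η → ∀ j : ℕ, 1 ≤ j →
        weightedVolume {x | (j : ℝ) < ψ x} ≤
          ENNReal.ofReal (2 * η * exp (-2 * (M * j ^ 2 : ℕ))) := by
      intro ψ hψ hcψ h1 h2 j hj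
      calc weightedVolume {x | (j : ℝ) < ψ x} ≤ smoothVolume {x | (j : ℝ) < ψ x} :=
            weightedVolume_le_smoothVolume _
        _ ≤ _ := H ψ hψ hcψ h1 ((volume_le_weightedVolume _).trans h2) j hj
        _ ≤ ENNReal.ofReal (exp (-2 * (M * j ^ 2 : ℕ))) * (2 * ENNReal.ofReal η) := by
            gcongr
            exact (smoothVolume_le _).trans (by gcongr)
        _ = _ := by
            rw [mul_comm, ENNReal.ofReal_mul (by positivity), ENNReal.ofReal_mul (by positivity),
              ENNReal.ofReal_ofNat]
    intro j hj
    have m1 : {x | 1 / 2 < φ x} ⊆ {x | 1 / 2 < |φ x|} := fun x hx =>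
      (show 1 / 2 < φ x from hx).trans_le (le_abs_self _)
    have m2 : {x | 1 / 2 < (-φ) x} ⊆ {x | 1 / 2 < |φ x|} := fun x hx =>
      (show 1 / 2 < -φ x from hx).trans_le (neg_le_abs _)
    have hE' : ∫⁻ x, ‖fderiv ℝ (-φ) x‖ₑ ^ 2 ≤ ENNReal.ofReal η := by
      have e : ∀ x, ‖fderiv ℝ (-φ) x‖ₑ = ‖fderiv ℝ φ x‖ₑ := fun x => by
        rw [fderiv_neg, ← ofReal_norm, norm_neg, ofReal_norm]
      simpa only [e] using hE
    have p1 := hone φ hφ hc hE ((measure_mono m1).trans hV) j hj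
    have p2 := hone (-φ) hφ.neg hc.neg hE'
      ((measure_mono m2).trans hV) j hj
    calc weightedVolume {x | (j : ℝ) < |φ x|}
        ≤ weightedVolume ({x | (j : ℝ) < φ x} ∪ {x | (j : ℝ) < (-φ) x}) :=
          measure_mono fun x hx => lt_abs.1 (show (j : ℝ) < |φ x| from hx)
      _ ≤ _ := (measure_union_le _ _).trans (add_le_add p1 p2)
      _ = _ := by
        rw [← ENNReal.ofReal_add (by positivity) (by positivity)]
        ring_nf
  calc ∫⁻ x in {x | 1 < |φ x|}, ENNReal.ofReal (exp (β * φ x ^ 2)) ∂weightedVolume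
      ≤ ∫⁻ x in {x | 1 < |φ x|}, ∑' j : ℕ, {y : ℝ | ((j + 1 : ℕ) : ℝ) < |y|}.indicator
          (fun _ => ENNReal.ofReal (exp (4 * β * ((j + 1 : ℕ) : ℝ) ^ 2))) (φ x)
          ∂weightedVolume := setLIntegral_mono' (hm 1) fun x hx => ofReal_exp_le_tsum hβ hx
    _ ≤ ∫⁻ x, ∑' j : ℕ, {x | ((j + 1 : ℕ) : ℝ) < |φ x|}.indicator
          (fun _ => ENNReal.ofReal (exp (4 * β * ((j + 1 : ℕ) : ℝ) ^ 2))) x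
          ∂weightedVolume := setLIntegral_le_lintegral _ _
    _ = ∑' j : ℕ, ENNReal.ofReal (exp (4 * β * ((j + 1 : ℕ) : ℝ) ^ 2)) *
          weightedVolume {x | ((j + 1 : ℕ) : ℝ) < |φ x|} := by
        rw [lintegral_tsum fun j => (measurable_const.indicator (hm _)).aemeasurable]
        simp only [lintegral_indicator_const (hm _)]
    _ ≤ _ := by
        refine ENNReal.tsum_le_tsum fun j => ?_
        refine (mul_le_mul_right (hle (j + 1) (by omega)) _).trans ?_
        rw [← ENNReal.ofReal_mul (exp_pos _).le]
        refine ENNReal.ofReal_le_ofReal ?_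
        rw [mul_left_comm, ← exp_add]
        gcongr
        push_cast
        have : (1 : ℝ) ≤ (j : ℝ) + 1 := by linarith [Nat.cast_nonneg (α := ℝ) j]
        nlinarith [mul_le_mul_of_nonneg_right hM (sq_nonneg ((j : ℝ) + 1))]

theorem rpow_abs_le_exp (q : ℝ) (hq : 0 ≤ q) (t : ℝ) : |t| ^ q ≤ exp (q * t ^ 2) := by
  have h : |t| ≤ exp (t ^ 2) := by
    refine le_trans ?_ (add_one_le_exp _)
    rw [← sq_abs]
    nlinarith [sq_nonneg (|t| - 1), abs_nonneg t]
  calc |t| ^ q ≤ exp (t ^ 2) ^ q := rpow_le_rpow (abs_nonneg t) h hq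
    _ = _ := by rw [← exp_mul, mul_comm]

/-- The integrand `|t| ^ q * exp (β t²)`, which dominates the nonlinearities near zero and at
infinity. -/
noncomputable def expPow (q β t : ℝ) : ℝ := |t| ^ q * exp (β * t ^ 2)

theorem expPow_nonneg (q β t : ℝ) : 0 ≤ expPow q β t := by unfold expPow; positivity

theorem continuous_expPow {q : ℝ} (hq : 0 ≤ q) (β : ℝ) : Continuous (expPow q β) := by
  unfold expPow
  exact (continuous_abs.rpow_const fun _ => .inr hq).mul (by fun_prop)

/-- A weighted Trudinger inequality for test functions with small energy and small weighted
`L^q` norm. Where `|φ| ≤ 1` the integrand is controlled by `|φ| ^ q`. -/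
theorem exists_lintegral_expPow_le_of_contDiff {q β : ℝ} (hq : 0 ≤ q) (hβ : 0 ≤ β) :
    ∃ ε : ℝ, 0 < ε ∧ ∃ K : ℝ≥0∞, K ≠ ⊤ ∧
    ∀ φ : Plane → ℝ, ContDiff ℝ 1 φ → HasCompactSupport φ →
    ∫⁻ x, ‖fderiv ℝ φ x‖ₑ ^ 2 ≤ ENNReal.ofReal ε →
    ∫⁻ x, ‖φ x‖ₑ ^ q ∂weightedVolume ≤ ENNReal.ofReal ε →
      ∫⁻ x, ENNReal.ofReal (expPow q β (φ x)) ∂weightedVolume ≤ K := by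
  obtain ⟨η, hη, K, hK, H⟩ := exists_lintegral_exp_le (β := q + β) (by positivity)
  refine ⟨η * (1 / 2) ^ q, by positivity, ENNReal.ofReal (exp β) * ENNReal.ofReal η + K,
    by finiteness, fun φ hφ hc hE hL => ?_⟩
  have hhalf : η * (1 / 2) ^ q ≤ η :=
    mul_le_of_le_one_right hη.le (rpow_le_one (by norm_num) (by norm_num) hq)
  have hm : MeasurableSet {x | 1 < |φ x|} :=
    measurableSet_lt measurable_const hφ.continuous.abs.measurable
  have hV : weightedVolume {x | 1 / 2 < |φ x|} ≤ ENNReal.ofReal η := by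
    have h1 : ENNReal.ofReal ((1 / 2) ^ q) * weightedVolume {x | 1 / 2 < |φ x|} ≤
        ENNReal.ofReal ((1 / 2) ^ q) * ENNReal.ofReal η := by
      rw [← ENNReal.ofReal_mul (by positivity), mul_comm _ η]
      refine le_trans ?_ hL
      refine le_trans ?_ (mul_meas_ge_le_lintegral
        (hφ.continuous.measurable.enorm.pow_const q) (ENNReal.ofReal ((1 / 2) ^ q)))
      refine mul_le_mul_right (measure_mono fun x hx => ?_) _
      change 1 / 2 < |φ x| at hx
      change ENNReal.ofReal ((1 / 2) ^ q) ≤ ‖φ x‖ₑ ^ q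
      rw [← ENNReal.ofReal_rpow_of_pos (by norm_num), ← ofReal_norm]
      gcongr
      exact hx.le
    refine (ENNReal.mul_le_mul_iff_right ?_ ENNReal.ofReal_ne_top).1 h1
    exact (ENNReal.ofReal_pos.2 (by positivity)).ne'
  rw [← lintegral_add_compl _ hm, add_comm]
  refine add_le_add ?_ ?_
  · calc ∫⁻ x in {x | 1 < |φ x|}ᶜ, ENNReal.ofReal (expPow q β (φ x)) ∂weightedVolume
        ≤ ∫⁻ x in {x | 1 < |φ x|}ᶜ, ENNReal.ofReal (exp β) * ‖φ x‖ₑ ^ q ∂weightedVolume := by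
          refine setLIntegral_mono' hm.compl fun x hx => ?_
          have hx : |φ x| ≤ 1 := not_lt.1 hx
          rw [← ofReal_norm, ENNReal.ofReal_rpow_of_nonneg (norm_nonneg _) hq,
            ← ENNReal.ofReal_mul (exp_pos _).le, mul_comm]
          refine ENNReal.ofReal_le_ofReal ?_
          unfold expPow
          rw [norm_eq_abs]
          gcongr
          have : φ x ^ 2 ≤ 1 := by rw [← sq_abs]; exact pow_le_one₀ (abs_nonneg _) hx
          nlinarith
      _ ≤ ∫⁻ x, ENNReal.ofReal (exp β) * ‖φ x‖ₑ ^ q ∂weightedVolume :=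
          setLIntegral_le_lintegral _ _
      _ ≤ _ := by
          rw [lintegral_const_mul _ (hφ.continuous.measurable.enorm.pow_const q)]
          gcongr
          exact hL.trans (ENNReal.ofReal_le_ofReal hhalf)
  · refine le_trans (lintegral_mono fun x => ENNReal.ofReal_le_ofReal ?_)
      (H φ hφ hc (hE.trans (ENNReal.ofReal_le_ofReal hhalf)) hV)
    rw [expPow, add_mul, exp_add]
    gcongr
    exact rpow_abs_le_exp q hq _

/-! ### Exponential integrability on the whole space -/

theorem lintegral_enorm_rpow_eq {α E : Type*} [MeasurableSpace α] {μ : Measure α}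
    [NormedAddCommGroup E] {q : ℝ≥0∞} [hq1 : Fact (1 ≤ q)] (hq : q ≠ ⊤) (f : Lp E q μ) :
    ∫⁻ x, ‖f x‖ₑ ^ q.toReal ∂μ = ‖f‖ₑ ^ q.toReal := by
  have h0 : q ≠ 0 := (zero_lt_one.trans_le hq1.out).ne'
  have h1 : q.toReal ≠ 0 := ENNReal.toReal_ne_zero.2 ⟨h0, hq⟩
  rw [Lp.enorm_def, eLpNorm_eq_lintegral_rpow_enorm_toReal h0 hq, ← ENNReal.rpow_mul,
    one_div_mul_cancel h1, ENNReal.rpow_one]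

theorem one_le_toReal {q : ℝ≥0∞} [hq1 : Fact (1 ≤ q)] (hq : q ≠ ⊤) : 1 ≤ q.toReal := by
  simpa using ENNReal.toReal_mono hq hq1.out

/-- The Trudinger inequality on a small ball of `H1Lq q`, from the one for test functions by
almost everywhere convergence of a subsequence and Fatou's lemma. -/
theorem exists_lintegral_expPow_le_of_mem_closure {q : ℝ≥0∞} [Fact (1 ≤ q)] (hq : q ≠ ⊤)
    {β : ℝ} (hβ : 0 ≤ β) : ∃ ε : ℝ, 0 < ε ∧ ∃ K : ℝ≥0∞, K ≠ ⊤ ∧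
      ∀ p ∈ (testPairs q).topologicalClosure, ‖p‖ < ε →
        ∫⁻ x, ENNReal.ofReal (expPow q.toReal β (p.fst x)) ∂weightedVolume ≤ K := by
  have hq1 := one_le_toReal hq
  obtain ⟨ε, hε, K, hK, H⟩ :=
    exists_lintegral_expPow_le_of_contDiff (q := q.toReal) (by positivity) hβ
  refine ⟨min 1 ε, by positivity, K, hK, ?_⟩
  have hpow : ∀ r t : ℝ, 1 ≤ r → 0 ≤ t → t < min 1 ε → t ^ r ≤ ε := fun r t hr ht h => by
    have := rpow_le_rpow_of_exponent_ge' ht (h.le.trans (min_le_left _ _)) zero_le_one hr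
    rw [rpow_one] at this
    exact this.trans (h.le.trans (min_le_right _ _))
  have htest : ∀ p ∈ testPairs q, ‖p‖ < min 1 ε →
      ∫⁻ x, ENNReal.ofReal (expPow q.toReal β (p.fst x)) ∂weightedVolume ≤ K := by
    rintro p ⟨φ, hφ, hc, h1, h2⟩ hp
    have e1 : ∫⁻ x, ‖fderiv ℝ φ x‖ₑ ^ 2 ≤ ENNReal.ofReal ε := by
      have : ∫⁻ x, ‖fderiv ℝ φ x‖ₑ ^ 2 = ‖p.snd‖ₑ ^ (2 : ℝ≥0∞).toReal := by
        rw [← lintegral_enorm_rpow_eq (by simp)]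
        refine lintegral_congr_ae ?_
        filter_upwards [h2] with x hx
        rw [hx, gradient, ← ofReal_norm, ← ofReal_norm, LinearIsometryEquiv.norm_map]
        simp
      rw [this, ← ofReal_norm, ENNReal.ofReal_rpow_of_nonneg (norm_nonneg _) (by simp)]
      refine ENNReal.ofReal_le_ofReal (hpow _ _ (by norm_num) (norm_nonneg _) ?_)
      exact (WithLp.norm_snd_le _ p).trans_lt hp
    have e2 : ∫⁻ x, ‖φ x‖ₑ ^ q.toReal ∂weightedVolume ≤ ENNReal.ofReal ε := by
      have : ∫⁻ x, ‖φ x‖ₑ ^ q.toReal ∂weightedVolume = ‖p.fst‖ₑ ^ q.toReal := by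
        rw [← lintegral_enorm_rpow_eq hq]
        refine lintegral_congr_ae ?_
        filter_upwards [h1] with x hx
        rw [hx]
      rw [this, ← ofReal_norm, ENNReal.ofReal_rpow_of_nonneg (norm_nonneg _) (by positivity)]
      refine ENNReal.ofReal_le_ofReal (hpow _ _ hq1 (norm_nonneg _) ?_)
      exact (WithLp.norm_fst_le _ p).trans_lt hp
    refine le_of_eq_of_le (lintegral_congr_ae ?_) (H φ (hφ.of_le (by simp)) hc e1 e2)
    filter_upwards [h1] with x hx
    rw [hx]
  intro p hp hlt
  obtain ⟨u, hu, hlim⟩ := mem_closure_iff_seq_limit.1 hp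
  have hfst : Tendsto (fun n => (u n).fst) atTop (𝓝 p.fst) :=
    ((WithLp.continuous_fst (p := 2) _ _).tendsto p).comp hlim
  obtain ⟨ns, hns, hae⟩ := (tendstoInMeasure_of_tendsto_Lp hfst).exists_seq_tendsto_ae
  have hcont := continuous_expPow (q := q.toReal) (by positivity) β
  calc ∫⁻ x, ENNReal.ofReal (expPow q.toReal β (p.fst x)) ∂weightedVolume
      = ∫⁻ x, liminf (fun n => ENNReal.ofReal (expPow q.toReal β ((u (ns n)).fst x))) atTop
          ∂weightedVolume := by
        refine lintegral_congr_ae ?_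
        filter_upwards [hae] with x hx
        exact (((ENNReal.continuous_ofReal.comp hcont).tendsto _).comp hx).liminf_eq.symm
    _ ≤ liminf (fun n => ∫⁻ x, ENNReal.ofReal (expPow q.toReal β ((u (ns n)).fst x))
          ∂weightedVolume) atTop :=
        lintegral_liminf_le fun n =>
          (hcont.measurable.comp (Lp.stronglyMeasurable _).measurable).ennreal_ofReal
    _ ≤ K := by
        refine liminf_le_of_frequently_le' (Eventually.frequently ?_)
        have : ∀ᶠ n in atTop, ‖u (ns n)‖ < min 1 ε :=
          ((hlim.comp hns.tendsto_atTop).norm).eventually_lt_const hlt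
        filter_upwards [this] with n hn
        exact htest _ (hu _) hn

/-- Splitting off a bounded function `b`: where `|a| > 2 M`, one has `|a| ≤ 2 |a - b|`. -/
theorem expPow_le_add {q β M a b : ℝ} (hq : 0 ≤ q) (hβ : 0 ≤ β) (hb : |b| ≤ M) :
    expPow q β a ≤ exp (4 * β * M ^ 2) * |a| ^ q + 2 ^ q * expPow q (4 * β) (a - b) := by
  have hM : 0 ≤ M := (abs_nonneg b).trans hb
  have h2 : 0 ≤ 2 ^ q * expPow q (4 * β) (a - b) :=
    mul_nonneg (by positivity) (expPow_nonneg _ _ _)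
  rcases le_or_gt |a| (2 * M) with h | h
  · refine le_add_of_le_of_nonneg ?_ h2
    have h3 : a ^ 2 ≤ 4 * M ^ 2 := by
      rw [← sq_abs]
      calc |a| ^ 2 ≤ (2 * M) ^ 2 := by gcongr
        _ = _ := by ring
    rw [expPow, mul_comm]
    exact mul_le_mul_of_nonneg_right (exp_le_exp.2 (by nlinarith)) (by positivity)
  · refine le_add_of_nonneg_of_le (by positivity) ?_
    have h3 : |a| ≤ 2 * |a - b| := by linarith [abs_sub_abs_le_abs_sub a b]
    have h4 : a ^ 2 ≤ 4 * (a - b) ^ 2 := by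
      rw [← sq_abs, ← sq_abs (a - b)]
      calc |a| ^ 2 ≤ (2 * |a - b|) ^ 2 := by gcongr
        _ = _ := by ring
    rw [expPow, expPow, ← mul_assoc, ← mul_rpow (by norm_num) (abs_nonneg _)]
    exact mul_le_mul (rpow_le_rpow (abs_nonneg _) h3 hq) (exp_le_exp.2 (by nlinarith))
      (exp_pos _).le (by positivity)

/-- Every exponential moment is locally bounded on `H1Lq q`: a nearby test function `φ` is bounded,
and `u - φ` lies in the small ball on which the Trudinger inequality holds. -/
theorem eventually_lintegral_expPow_le {q : ℝ≥0∞} [Fact (1 ≤ q)] (hq : q ≠ ⊤)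
    {β : ℝ} (hβ : 0 ≤ β) (u₀ : H1Lq q) : ∃ K : ℝ≥0∞, K ≠ ⊤ ∧ ∀ᶠ u in 𝓝 u₀,
      ∫⁻ x, ENNReal.ofReal (expPow q.toReal β (u.toFun x)) ∂weightedVolume ≤ K := by
  have hq1 := one_le_toReal hq
  have hq0 : 0 ≤ q.toReal := by positivity
  obtain ⟨ε, hε, K, hK, H⟩ := exists_lintegral_expPow_le_of_mem_closure hq
    (β := 4 * β) (by positivity)
  obtain ⟨p, hp, hdist⟩ := Metric.mem_closure_iff.1 u₀.2 (ε / 2) (by positivity)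
  have hpc : p ∈ (testPairs q).topologicalClosure := (testPairs q).le_topologicalClosure hp
  obtain ⟨φ, hφ, hc, h1, -⟩ := hp
  obtain ⟨M, hM⟩ := hc.exists_bound_of_continuous hφ.continuous
  refine ⟨ENNReal.ofReal (exp (4 * β * M ^ 2)) * (‖(u₀ : Ambient q)‖ₑ + 1) ^ q.toReal
    + ENNReal.ofReal (2 ^ q.toReal) * K, by finiteness, ?_⟩
  filter_upwards [Metric.ball_mem_nhds u₀ (show 0 < min 1 (ε / 2) by positivity)] with u hu
  rw [Metric.mem_ball, lt_min_iff] at hu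
  set v : Ambient q := (u : Ambient q) - p with hv
  have hvε : ‖v‖ < ε := by
    rw [hv, ← dist_eq_norm]
    have h2 : dist (u : Ambient q) u₀ < ε / 2 := hu.2
    linarith [dist_triangle (u : Ambient q) u₀ p]
  have hvae : v.fst =ᵐ[weightedVolume] fun x => u.toFun x - φ x := by
    have h3 : v.fst = (u : Ambient q).fst - p.fst := rfl
    rw [h3]
    filter_upwards [Lp.coeFn_sub (u : Ambient q).fst p.fst, h1] with x hx1 hx2
    rw [hx1, Pi.sub_apply, hx2, H1Lq.toFun]
  have hum : Measurable u.toFun := (Lp.stronglyMeasurable (u : Ambient q).fst).measurable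
  have hunorm : ‖(u : Ambient q).fst‖ₑ ≤ ‖(u₀ : Ambient q)‖ₑ + 1 := by
    refine (WithLp.enorm_fst_le _ _).trans ?_
    have h4 : ‖(u : Ambient q)‖ ≤ ‖(u₀ : Ambient q)‖ + 1 := by
      have h2 : dist (u : Ambient q) u₀ < 1 := hu.1
      rw [dist_eq_norm] at h2
      linarith [norm_le_norm_add_norm_sub' (u : Ambient q) (u₀ : Ambient q)]
    rw [← ofReal_norm, ← ofReal_norm, ← ENNReal.ofReal_one,
      ← ENNReal.ofReal_add (norm_nonneg _) zero_le_one]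
    exact ENNReal.ofReal_le_ofReal h4
  calc ∫⁻ x, ENNReal.ofReal (expPow q.toReal β (u.toFun x)) ∂weightedVolume
      ≤ ∫⁻ x, (ENNReal.ofReal (exp (4 * β * M ^ 2)) * ‖u.toFun x‖ₑ ^ q.toReal +
          ENNReal.ofReal (2 ^ q.toReal) *
            ENNReal.ofReal (expPow q.toReal (4 * β) (v.fst x))) ∂weightedVolume := by
        refine lintegral_mono_ae ?_
        filter_upwards [hvae] with x hx
        rw [hx, ← ofReal_norm, ENNReal.ofReal_rpow_of_nonneg (norm_nonneg _) hq0,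
          ← ENNReal.ofReal_mul (by positivity), ← ENNReal.ofReal_mul (by positivity),
          ← ENNReal.ofReal_add (by positivity)
            (mul_nonneg (by positivity) (expPow_nonneg _ _ _))]
        exact ENNReal.ofReal_le_ofReal (expPow_le_add hq0 hβ (hM x))
    _ = ENNReal.ofReal (exp (4 * β * M ^ 2)) * ‖(u : Ambient q).fst‖ₑ ^ q.toReal +
          ENNReal.ofReal (2 ^ q.toReal) *
            ∫⁻ x, ENNReal.ofReal (expPow q.toReal (4 * β) (v.fst x)) ∂weightedVolume := by
        rw [lintegral_add_left ((hum.enorm.pow_const _).const_mul _),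
          lintegral_const_mul _ (hum.enorm.pow_const _), lintegral_const_mul, H1Lq.toFun,
          lintegral_enorm_rpow_eq hq]
        exact ((continuous_expPow hq0 _).measurable.comp
          (Lp.stronglyMeasurable _).measurable).ennreal_ofReal
    _ ≤ _ := by
        gcongr
        exact H v (Submodule.sub_mem _ u.2 hpc) hvε

/-! ### Local Lipschitz continuity of superposition functionals -/

theorem expPow_rpow {q r β : ℝ} (hqr : q.HolderConjugate r) (t : ℝ) :
    expPow (q - 1) β t ^ r = expPow q (r * β) t := by
  rw [expPow, expPow, mul_rpow (by positivity) (exp_pos _).le, ← rpow_mul (abs_nonneg _),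
    ← exp_mul, hqr.sub_one_mul_conj]
  ring_nf

/-- A functional `u ↦ ∫ G (x, u) w₀ dx` is finite and continuous when the Lipschitz constant of
`G x` at height `t` is at most of order `|t| ^ (q - 1) * exp (β t²)`. Hölder's inequality pairs
`u - v` in `L^q(w₀ dx)` with this factor in the conjugate space, where its norm is an exponential
moment. -/
theorem integrable_and_continuous_integral {q : ℝ≥0∞} [Fact (1 ≤ q)] (hq2 : 2 ≤ q) (hq : q ≠ ⊤)
    {G : Plane → ℝ → ℝ} (hGm : Measurable (Function.uncurry G)) (hG0 : ∀ x, G x 0 = 0)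
    {C β : ℝ} (hC : 0 ≤ C) (hβ : 0 ≤ β) (hG : ∀ x a b, |G x a - G x b| ≤
      C * |a - b| * (expPow (q.toReal - 1) β a + expPow (q.toReal - 1) β b)) :
    (∀ u : H1Lq q, Integrable (fun x => G x (u.toFun x)) weightedVolume) ∧
      Continuous fun u : H1Lq q => ∫ x, G x (u.toFun x) ∂weightedVolume := by
  have hq2' : 2 ≤ q.toReal := by simpa using ENNReal.toReal_mono hq hq2
  have hq1 : 1 < q.toReal := by linarith
  have hqr := Real.HolderConjugate.conjExponent hq1
  set r := q.toReal.conjExponent with hr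
  have hr0 : 0 < r := hqr.symm.pos
  have hum : ∀ u : H1Lq q, Measurable u.toFun := fun u =>
    (Lp.stronglyMeasurable (u : Ambient q).fst).measurable
  have hGu : ∀ u : H1Lq q, Measurable fun x => G x (u.toFun x) := fun u =>
    hGm.comp (measurable_id.prodMk (hum u))
  have hAm : ∀ u : H1Lq q, Measurable fun x =>
      ENNReal.ofReal (expPow (q.toReal - 1) β (u.toFun x)) := fun u =>
    ((continuous_expPow (by linarith) _).measurable.comp (hum u)).ennreal_ofReal
  have hholder : ∀ u w : H1Lq q,
      ∫⁻ x, ‖w.toFun x‖ₑ * ENNReal.ofReal (expPow (q.toReal - 1) β (u.toFun x))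
        ∂weightedVolume ≤ ‖w‖ₑ *
        (∫⁻ x, ENNReal.ofReal (expPow q.toReal (r * β) (u.toFun x)) ∂weightedVolume) ^ (1 / r) := by
    intro u w
    refine (ENNReal.lintegral_mul_le_Lp_mul_Lq weightedVolume hqr
      (hum w).enorm.aemeasurable (hAm u).aemeasurable).trans ?_
    gcongr ?_ * ?_
    · have e : ∫⁻ x, ‖w.toFun x‖ₑ ^ q.toReal ∂weightedVolume =
          ‖(w : Ambient q).fst‖ₑ ^ q.toReal := lintegral_enorm_rpow_eq hq _
      rw [e, ← ENNReal.rpow_mul, mul_one_div_cancel (by linarith), ENNReal.rpow_one]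
      exact WithLp.enorm_fst_le _ _
    · refine le_of_eq ?_
      congr 1
      refine lintegral_congr fun x => ?_
      rw [ENNReal.ofReal_rpow_of_nonneg (expPow_nonneg _ _ _) hr0.le, expPow_rpow hqr]
  have hdiff : ∀ u v : H1Lq q, ∫⁻ x, ‖G x (u.toFun x) - G x (v.toFun x)‖ₑ ∂weightedVolume ≤
      ENNReal.ofReal C * (‖u - v‖ₑ * (
        (∫⁻ x, ENNReal.ofReal (expPow q.toReal (r * β) (u.toFun x)) ∂weightedVolume) ^ (1 / r) +
        (∫⁻ x, ENNReal.ofReal (expPow q.toReal (r * β) (v.toFun x)) ∂weightedVolume)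
          ^ (1 / r))) := by
    intro u v
    have hw : (u - v).toFun =ᵐ[weightedVolume] fun x => u.toFun x - v.toFun x :=
      Lp.coeFn_sub (u : Ambient q).fst (v : Ambient q).fst
    calc ∫⁻ x, ‖G x (u.toFun x) - G x (v.toFun x)‖ₑ ∂weightedVolume
        ≤ ∫⁻ x, ENNReal.ofReal C *
            (‖(u - v).toFun x‖ₑ * ENNReal.ofReal (expPow (q.toReal - 1) β (u.toFun x)) +
            ‖(u - v).toFun x‖ₑ * ENNReal.ofReal (expPow (q.toReal - 1) β (v.toFun x)))
            ∂weightedVolume := by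
          refine lintegral_mono_ae ?_
          filter_upwards [hw] with x hx
          rw [hx, ← mul_add, ← ENNReal.ofReal_add (expPow_nonneg _ _ _) (expPow_nonneg _ _ _),
            ← ofReal_norm, ← ofReal_norm, ← ENNReal.ofReal_mul (norm_nonneg _),
            ← ENNReal.ofReal_mul hC, ← mul_assoc]
          exact ENNReal.ofReal_le_ofReal (hG x _ _)
      _ ≤ _ := by
          have hm : ∀ z : H1Lq q, Measurable fun x => ‖(u - v).toFun x‖ₑ *
              ENNReal.ofReal (expPow (q.toReal - 1) β (z.toFun x)) := fun z =>
            (hum (u - v)).enorm.mul (hAm z)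
          rw [lintegral_const_mul _ ((hm u).fun_add (hm v)), lintegral_add_left (hm u),
            mul_add ‖u - v‖ₑ]
          gcongr
          · exact hholder u _
          · exact hholder v _
  have hint : ∀ u : H1Lq q, Integrable (fun x => G x (u.toFun x)) weightedVolume := by
    intro u
    refine ⟨(hGu u).aestronglyMeasurable, ?_⟩
    obtain ⟨K, hK, h⟩ := eventually_lintegral_expPow_le hq (β := r * β) (by positivity) u
    obtain ⟨L, hL, h'⟩ := eventually_lintegral_expPow_le hq (β := r * β) (by positivity)
      (0 : H1Lq q)
    have h0 : (0 : H1Lq q).toFun =ᵐ[weightedVolume] 0 := Lp.coeFn_zero ℝ q weightedVolume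
    calc ∫⁻ x, ‖G x (u.toFun x)‖ₑ ∂weightedVolume
        = ∫⁻ x, ‖G x (u.toFun x) - G x ((0 : H1Lq q).toFun x)‖ₑ ∂weightedVolume := by
          refine lintegral_congr_ae ?_
          filter_upwards [h0] with x hx
          rw [hx, Pi.zero_apply, hG0, sub_zero]
      _ ≤ ENNReal.ofReal C * (‖u - 0‖ₑ * (K ^ (1 / r) + L ^ (1 / r))) := by
          refine (hdiff u 0).trans ?_
          gcongr
          · exact h.self_of_nhds
          · exact h'.self_of_nhds
      _ < ⊤ := by finiteness
  refine ⟨hint, continuous_iff_continuousAt.2 fun u₀ => ?_⟩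
  obtain ⟨K, hK, hev⟩ := eventually_lintegral_expPow_le hq (β := r * β) (by positivity) u₀
  refine tendsto_integral_of_L1 _ (hint u₀).aestronglyMeasurable (.of_forall hint) ?_
  have hlim : Tendsto (fun u : H1Lq q => ENNReal.ofReal C *
      (‖u - u₀‖ₑ * (K ^ (1 / r) + K ^ (1 / r)))) (𝓝 u₀) (𝓝 0) := by
    have h1 : Tendsto (fun u : H1Lq q => ‖u - u₀‖ₑ) (𝓝 u₀) (𝓝 0) := by
      have : Continuous fun u : H1Lq q => ENNReal.ofReal ‖u - u₀‖ :=
        ENNReal.continuous_ofReal.comp (by fun_prop)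
      simpa only [ofReal_norm, sub_self, norm_zero, ENNReal.ofReal_zero] using this.tendsto u₀
    have h2 := ENNReal.Tendsto.const_mul (a := ENNReal.ofReal C)
      (ENNReal.Tendsto.mul_const (b := K ^ (1 / r) + K ^ (1 / r)) h1 (.inr (by finiteness)))
      (.inr ENNReal.ofReal_ne_top)
    simpa using h2
  refine tendsto_of_tendsto_of_tendsto_of_le_of_le' tendsto_const_nhds hlim
    (.of_forall fun _ => zero_le) ?_
  filter_upwards [hev] with u hu
  refine (hdiff u u₀).trans ?_
  gcongr
  exact hev.self_of_nhds

/-! ### The weighted measure as a density -/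

theorem w₀_toReal (x : Plane) : (ENNReal.ofReal (w₀ x)).toReal = w₀ x :=
  ENNReal.toReal_ofReal (by linarith [one_le_w₀ x])

theorem integrable_weightedVolume_iff {g : Plane → ℝ} :
    Integrable g weightedVolume ↔ Integrable fun x => g x * log (exp 1 + ‖x‖) := by
  rw [weightedVolume, integrable_withDensity_iff_integrable_smul'
    continuous_w₀.measurable.ennreal_ofReal (.of_forall fun _ => ENNReal.ofReal_lt_top)]
  simp only [w₀_toReal, smul_eq_mul]
  simp only [mul_comm, w₀]

theorem integral_weightedVolume (g : Plane → ℝ) :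
    ∫ x, g x ∂weightedVolume = ∫ x, g x * log (exp 1 + ‖x‖) := by
  rw [weightedVolume, integral_withDensity_eq_integral_toReal_smul
    continuous_w₀.measurable.ennreal_ofReal (.of_forall fun _ => ENNReal.ofReal_lt_top)]
  simp only [w₀_toReal, smul_eq_mul]
  simp only [mul_comm, w₀]

/-! ### Bounds on the coefficient and on the nonlinearities -/

theorem IsCoefficient.exists_le {c : Plane → ℝ} (hc : IsCoefficient c) : ∃ B, ∀ x, c x ≤ B := by
  have hper : ∀ (i : Fin 2) (x : Plane) (n : ℤ), c (x + EuclideanSpace.single i (n : ℝ)) = c x := by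
    intro i x n
    have h1 : Function.Periodic c (EuclideanSpace.single i (1 : ℝ)) := hc.periodic i
    have h2 := h1.zsmul n x
    rwa [show n • EuclideanSpace.single i (1 : ℝ) = EuclideanSpace.single i (n : ℝ) by
      ext j; simp] at h2
  obtain ⟨B, hB⟩ := (ProperSpace.isCompact_closedBall (0 : Plane) 2).exists_bound_of_continuousOn
    hc.continuous.continuousOn
  refine ⟨B, fun x => ?_⟩
  set y : Plane := x + EuclideanSpace.single 0 ((-⌊x 0⌋ : ℤ) : ℝ)
    + EuclideanSpace.single 1 ((-⌊x 1⌋ : ℤ) : ℝ) with hy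
  have hcy : c y = c x := by rw [hy, hper, hper]
  have y0 : y 0 = Int.fract (x 0) := by simp [hy, Int.fract, sub_eq_add_neg]
  have y1 : y 1 = Int.fract (x 1) := by simp [hy, Int.fract, sub_eq_add_neg]
  rw [← hcy]
  refine (le_abs_self _).trans (hB y ?_)
  rw [mem_closedBall_zero_iff, EuclideanSpace.norm_eq, Fin.sum_univ_two, y0, y1]
  refine sqrt_le_iff.2 ⟨by norm_num, ?_⟩
  rw [norm_eq_abs, norm_eq_abs, sq_abs, sq_abs]
  nlinarith [Int.fract_nonneg (x 0), Int.fract_lt_one (x 0), Int.fract_nonneg (x 1),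
    Int.fract_lt_one (x 1)]

/-- The growth conditions at zero and at infinity, together with continuity in between, give one
bound on the half-line. The exponent exceeds `4 π` in order to absorb the power at infinity. -/
theorem HasCriticalGrowth.exists_le {q : ℝ} {f : ℝ → ℝ} (hf : HasCriticalGrowth q f) :
    ∃ C β : ℝ, 0 ≤ C ∧ 0 ≤ β ∧ ∀ t, 0 < t → f t ≤ C * expPow (q - 1) β t := by
  obtain ⟨C₁, hC₁, h1⟩ := hf.growth_zero.1.exists_pos
  rw [Asymptotics.isBigOWith_iff, eventually_nhdsWithin_iff, Metric.eventually_nhds_iff] at h1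
  obtain ⟨δ, hδ, h1⟩ := h1
  obtain ⟨p, hp, C₂, h2⟩ := hf.growth_infty
  obtain ⟨R, h2⟩ := eventually_atTop.1 h2
  set b : ℝ := 4 * π + |p - (q - 1)| with hb
  have hb0 : 0 ≤ b := by positivity
  have hcont : ContinuousOn f (Set.Icc δ (max R 1)) :=
    hf.differentiableOn.continuousOn.mono fun t ht => hδ.le.trans ht.1
  have hpos : ∀ t, 0 < t → 0 < expPow (q - 1) b t := fun t ht => by
    unfold expPow; positivity
  have hcont' : ContinuousOn (fun t => f t / expPow (q - 1) b t) (Set.Icc δ (max R 1)) := by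
    refine hcont.div ?_ fun t ht => (hpos t (hδ.trans_le ht.1)).ne'
    unfold expPow
    refine ContinuousOn.mul (ContinuousOn.rpow_const continuous_abs.continuousOn fun t ht => ?_)
      (by fun_prop)
    exact .inl (abs_pos.2 (hδ.trans_le ht.1).ne').ne'
  obtain ⟨C₃, h3⟩ := isCompact_Icc.exists_bound_of_continuousOn hcont'
  refine ⟨C₁ + |C₂| + |C₃|, b, by positivity, hb0, fun t ht => ?_⟩
  have ht' := hpos t ht
  suffices f t ≤ C₁ * expPow (q - 1) b t ∨ f t ≤ |C₂| * expPow (q - 1) b t ∨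
      f t ≤ |C₃| * expPow (q - 1) b t by
    have i1 := mul_nonneg hC₁.le ht'.le
    have i2 := mul_nonneg (abs_nonneg C₂) ht'.le
    have i3 := mul_nonneg (abs_nonneg C₃) ht'.le
    rcases this with h | h | h <;> linarith
  rcases lt_or_ge t δ with h | h
  · left
    have h4 := h1 (y := t) (by simpa [abs_of_pos ht] using h) ht
    refine (le_abs_self _).trans (h4.trans ?_)
    rw [norm_of_nonneg (by positivity), expPow, abs_of_pos ht]
    gcongr
    exact le_mul_of_one_le_right (by positivity) (one_le_exp (by positivity))
  right
  rcases lt_or_ge (max R 1) t with h' | h'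
  · left
    have ht1 : 1 ≤ t := (le_max_right _ _).trans h'.le
    refine (h2 t ((le_max_left _ _).trans h'.le)).trans ?_
    rw [expPow, abs_of_pos ht, mul_assoc]
    refine mul_le_mul (le_abs_self _) ?_ (by positivity) (abs_nonneg _)
    rw [hb, add_mul, exp_add, mul_comm (exp _), ← mul_assoc]
    gcongr
    calc t ^ p = t ^ (q - 1) * t ^ (p - (q - 1)) := by rw [← rpow_add ht]; ring_nf
      _ ≤ t ^ (q - 1) * t ^ |p - (q - 1)| := by
        gcongr
        exact le_abs_self _
      _ ≤ t ^ (q - 1) * exp (|p - (q - 1)| * t ^ 2) := by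
        gcongr
        simpa [abs_of_pos ht] using rpow_abs_le_exp _ (abs_nonneg (p - (q - 1))) t
  · right
    have h5 := (le_abs_self _).trans ((h3 t ⟨h, h'⟩).trans (le_abs_self C₃))
    exact (div_le_iff₀ ht').1 h5

theorem expPow_mono {q β s t : ℝ} (hq : 0 ≤ q) (hβ : 0 ≤ β) (h : |s| ≤ |t|) :
    expPow q β s ≤ expPow q β t := by
  have := sq_le_sq.2 h
  unfold expPow
  gcongr

theorem abs_exp_sub_exp_le {α : ℝ} (hα : 0 ≤ α) (a b : ℝ) :
    |(exp (α * a ^ 2) - 1) - (exp (α * b ^ 2) - 1)| ≤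
      2 * α * |a - b| * (expPow 1 α a + expPow 1 α b) := by
  wlog h : |b| ≤ |a| generalizing a b
  · have := this b a (le_of_not_ge h)
    rwa [abs_sub_comm, abs_sub_comm b a, add_comm (expPow 1 α b)] at this
  have hsq : b ^ 2 ≤ a ^ 2 := sq_le_sq.2 h
  have hnn : 0 ≤ 2 * α * |a - b| * expPow 1 α b :=
    mul_nonneg (by positivity) (expPow_nonneg _ _ _)
  rw [sub_sub_sub_cancel_right, abs_of_nonneg (sub_nonneg.2 (by gcongr)), mul_add]
  refine le_add_of_le_of_nonneg ?_ hnn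
  have h1 : exp (α * b ^ 2) = exp (α * a ^ 2) * exp (-(α * (a ^ 2 - b ^ 2))) := by
    rw [← exp_add]; ring_nf
  have h2 := add_one_le_exp (-(α * (a ^ 2 - b ^ 2)))
  have h3 : a ^ 2 - b ^ 2 ≤ 2 * |a - b| * |a| := by
    calc a ^ 2 - b ^ 2 = (|a| - |b|) * (|a| + |b|) := by rw [← sq_abs a, ← sq_abs b]; ring
      _ ≤ |a - b| * (|a| + |a|) :=
        mul_le_mul (abs_sub_abs_le_abs_sub a b) (by linarith) (by positivity) (abs_nonneg _)
      _ = _ := by ring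
  calc exp (α * a ^ 2) - exp (α * b ^ 2)
      = exp (α * a ^ 2) * (1 - exp (-(α * (a ^ 2 - b ^ 2)))) := by rw [h1]; ring
    _ ≤ exp (α * a ^ 2) * (α * (2 * |a - b| * |a|)) := by
      gcongr
      nlinarith
    _ = _ := by rw [expPow, rpow_one]; ring

theorem abs_integral_sub_integral_le {q α β C : ℝ} {f : ℝ → ℝ} (hq : 1 ≤ q) (hα : 0 < α)
    (hβ : 0 ≤ β) (hC : 0 ≤ C) (hf : ContinuousOn f (Set.Ici 0))
    (hle : ∀ t, 0 < t → |f t| ≤ C * expPow (q - 1) β t) (a b : ℝ) :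
    |(∫ t in (0 : ℝ)..α * |a|, f t) - ∫ t in (0 : ℝ)..α * |b|, f t| ≤
      C * α ^ q * |a - b| * (expPow (q - 1) (α ^ 2 * β) a + expPow (q - 1) (α ^ 2 * β) b) := by
  have hint : ∀ s, 0 ≤ s → IntervalIntegrable f volume 0 s := fun s hs =>
    (hf.mono fun t ht => by
      rw [Set.uIcc_of_le hs] at ht
      exact ht.1).intervalIntegrable
  have hscale : ∀ s, expPow (q - 1) β (α * s) = α ^ (q - 1) * expPow (q - 1) (α ^ 2 * β) s :=
    fun s => by
      rw [expPow, expPow, abs_mul, abs_of_pos hα, mul_rpow hα.le (abs_nonneg _)]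
      ring_nf
  rw [intervalIntegral.integral_interval_sub_left (hint _ (by positivity)) (hint _ (by positivity)),
    ← norm_eq_abs]
  refine (intervalIntegral.norm_integral_le_of_norm_le_const (C := C * (α ^ (q - 1) *
    (expPow (q - 1) (α ^ 2 * β) a + expPow (q - 1) (α ^ 2 * β) b))) fun t ht => ?_).trans ?_
  · have ht0 : 0 < t := (le_min (by positivity) (by positivity)).trans_lt ht.1
    have ht1 : t ≤ max (α * |b|) (α * |a|) := ht.2
    refine (hle t ht0).trans ?_
    gcongr
    rw [mul_add, ← hscale, ← hscale]
    have ia := expPow_nonneg (q - 1) β (α * a)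
    have ib := expPow_nonneg (q - 1) β (α * b)
    have hm : ∀ s, t ≤ α * |s| → expPow (q - 1) β t ≤ expPow (q - 1) β (α * s) := fun s hs =>
      expPow_mono (by linarith) hβ (by rwa [abs_of_pos ht0, abs_mul, abs_of_pos hα])
    rcases le_max_iff.1 ht1 with h | h
    · linarith [hm b h]
    · linarith [hm a h]
  · have h1 : |α * |a| - α * (|b|)| ≤ α * |a - b| := by
      rw [← mul_sub, abs_mul, abs_of_pos hα]
      exact mul_le_mul_of_nonneg_left (abs_abs_sub_abs_le_abs_sub a b) hα.le
    have h2 : α ^ q = α ^ (q - 1) * α := by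
      rw [← rpow_add_one hα.ne', sub_add_cancel]
    have i := add_nonneg (expPow_nonneg (q - 1) (α ^ 2 * β) a)
      (expPow_nonneg (q - 1) (α ^ 2 * β) b)
    calc _ ≤ _ := mul_le_mul_of_nonneg_left h1 (mul_nonneg hC (mul_nonneg (by positivity) i))
      _ = _ := by rw [h2]; ring

/-- The values of `f` at negative arguments are arbitrary, so `f` is replaced by `f ∘ |·|`, which
is continuous on the whole line. -/
theorem measurable_primitive {c : Plane → ℝ} (hc : Continuous c) {f : ℝ → ℝ}
    (hf : ContinuousOn f (Set.Ici 0)) {α : ℝ} (hα : 0 ≤ α) :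
    Measurable (Function.uncurry fun x s => primitive c f x (α * |s|)) := by
  have hp : Continuous fun s => ∫ t in (0 : ℝ)..s, f |t| :=
    intervalIntegral.continuous_primitive
      (fun a b => (hf.comp_continuous continuous_abs fun t => abs_nonneg t).intervalIntegrable a b) 0
  have he : (Function.uncurry fun x s => primitive c f x (α * |s|)) =
      fun z : Plane × ℝ => c z.1 * ∫ t in (0 : ℝ)..α * |z.2|, f |t| := by
    ext z
    simp only [Function.uncurry, primitive]
    congr 1
    refine intervalIntegral.integral_congr fun t ht => ?_
    rw [Set.uIcc_of_le (by positivity)] at ht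
    simp only [abs_of_nonneg ht.1]
  rw [he]
  exact ((hc.comp continuous_fst).mul
    (hp.comp (continuous_const.mul continuous_snd.abs))).measurable

end LogWeighted

theorem corollary3p1 :
    (∀ α : ℝ, 0 < α →
      (∀ u : LogWeighted.H1w₀,
        Integrable (fun x : LogWeighted.Plane =>
          (Real.exp (α * (u.toFun x) ^ 2) - 1) * Real.log (Real.exp 1 + ‖x‖))) ∧
      Continuous (fun u : LogWeighted.H1w₀ =>
        ∫ x : LogWeighted.Plane,
          (Real.exp (α * (u.toFun x) ^ 2) - 1) * Real.log (Real.exp 1 + ‖x‖))) ∧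
    (∀ (q : ℝ≥0∞) [Fact (1 ≤ q)], 2 ≤ q → q ≠ ⊤ →
      ∀ (c : LogWeighted.Plane → ℝ) (f : ℝ → ℝ),
        LogWeighted.IsCoefficient c → LogWeighted.HasCriticalGrowth q.toReal f →
      ∀ α : ℝ, 0 < α →
        (∀ u : LogWeighted.H1Lq q,
          Integrable (fun x : LogWeighted.Plane =>
            LogWeighted.primitive c f x (α * |u.toFun x|) * Real.log (Real.exp 1 + ‖x‖))) ∧
        Continuous (fun u : LogWeighted.H1Lq q =>
          ∫ x : LogWeighted.Plane,
            LogWeighted.primitive c f x (α * |u.toFun x|) * Real.log (Real.exp 1 + ‖x‖))) := by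
  refine ⟨fun α hα => ?_, fun q _ hq2 hq c f hc hf α hα => ?_⟩
  · have h := LogWeighted.integrable_and_continuous_integral (q := 2) le_rfl (by simp)
      (G := fun _ s => Real.exp (α * s ^ 2) - 1) (C := 2 * α) (β := α)
      (by unfold Function.uncurry; fun_prop) (fun _ => by simp) (by positivity) hα.le
      (fun _ a b => by
        have e : (2 : ℝ≥0∞).toReal - 1 = 1 := by norm_num
        rw [e]
        exact LogWeighted.abs_exp_sub_exp_le hα.le a b)
    simpa only [LogWeighted.integrable_weightedVolume_iff,
      LogWeighted.integral_weightedVolume] using h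
  · have hq1 := LogWeighted.one_le_toReal hq
    obtain ⟨B, hB⟩ := hc.exists_le
    obtain ⟨C, β, hC, hβ, hle⟩ := hf.exists_le
    have hB0 : 0 ≤ B := (hc.pos 0).le.trans (hB 0)
    have hcont := hf.differentiableOn.continuousOn
    have h := LogWeighted.integrable_and_continuous_integral hq2 hq
      (G := fun x s => LogWeighted.primitive c f x (α * |s|)) (C := B * (C * α ^ q.toReal))
      (β := α ^ 2 * β) (LogWeighted.measurable_primitive hc.continuous hcont hα.le)
      (fun x => by simp [LogWeighted.primitive]) (by positivity) (by positivity)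
      (fun x a b => by
        have h1 := LogWeighted.abs_integral_sub_integral_le hq1 hα hβ hC hcont
          (fun t ht => by rw [abs_of_nonneg (hf.nonneg t ht.le)]; exact hle t ht) a b
        rw [LogWeighted.primitive, LogWeighted.primitive, ← mul_sub, abs_mul,
          abs_of_pos (hc.pos x), mul_assoc B, mul_assoc B]
        exact mul_le_mul (hB x) h1 (abs_nonneg _) hB0)
    simpa only [LogWeighted.integrable_weightedVolume_iff,
      LogWeighted.integral_weightedVolume] using h
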